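/- Let $C>0$ and $0\le\gamma<1$. There are constants $c_1,c_2>0$, depending only on $C$ and $\gamma$, such that the following holds for all natural numbers $k,d,n,m$. Let $G:\mathbb{R}^k\to\mathbb{R}^n$ be a feedforward neural network with $d\ge 1$ layers, ReLU activations and at most $n$ nodes per layer (every layer is an affine map followed by coordinatewise $t\mapsto\max(t,0)$, which may be omitted in the output layer). Let $A\in\mathbb{R}^{m\times n}$ be a random matrix whose rows $a_1,\dots,a_m$ are independent and identically distributed, isotropic ($\mathbb{E}[a_ia_i^{\top}]=I_n$), and satisfy the bounded fourth-moment condition \[ \left(\mathbb{E}\left[\langle a_i,u\rangle^4\right]\right)^{1/4}\le C\left(\mathbb{E}\left[\langle a_i,u\rangle^2\right]\right)^{1/2}<\infty\qquad\text{for all }u\in\mathbb{R}^n . \] If \[ m\;\ge\; c_1\,\frac{1}{1-\gamma^2}\,kd\log n , \] then with probability at least $1-e^{-c_2m}$ we have, for all $z_1,z_2\in\mathbb{R}^k$ simultaneously, \[ \frac1m\left\|AG(z_1)-AG(z_2)\right\|^2\;\ge\;\gamma^2\left\|G(z_1)-G(z_2)\right\|^2 . \] -/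

import Mathlib

open MeasureTheory ProbabilityTheory

/-- The affine map `x ↦ W x + b` between Euclidean spaces (a layer before its activation). -/
noncomputable def affineLayer {p q : ℕ} (W : Matrix (Fin q) (Fin p) ℝ)
    (b : EuclideanSpace ℝ (Fin q)) (x : EuclideanSpace ℝ (Fin p)) : EuclideanSpace ℝ (Fin q) :=
  W.toEuclideanLin x + b

/-- The ReLU activation `t ↦ max t 0`, applied to every coordinate. -/
noncomputable def relu {q : ℕ} (x : EuclideanSpace ℝ (Fin q)) : EuclideanSpace ℝ (Fin q) :=
  WithLp.toLp 2 (fun i => max (x i) 0)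

/-- `HiddenLayers k N l w F`: the function `F : ℝᵏ → ℝʷ` is the composition of `l` layers, each of
them an affine map followed by ReLU, and each of them having at most `N` nodes. -/
inductive HiddenLayers (k N : ℕ) :
    ℕ → (w : ℕ) → (EuclideanSpace ℝ (Fin k) → EuclideanSpace ℝ (Fin w)) → Prop
  | input : HiddenLayers k N 0 k id
  | layer {l w w' : ℕ} {F : EuclideanSpace ℝ (Fin k) → EuclideanSpace ℝ (Fin w)}
      (hF : HiddenLayers k N l w F) (hw' : w' ≤ N)
      (W : Matrix (Fin w') (Fin w) ℝ) (b : EuclideanSpace ℝ (Fin w')) :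
      HiddenLayers k N (l + 1) w' (fun z => relu (affineLayer W b (F z)))

/-- `G : ℝᵏ → ℝⁿ` is a feedforward neural network with ReLU activations and `d` layers, with at
most `n` nodes per layer: `d - 1` hidden layers followed by an output layer, which may or may not
carry an activation. (In particular `d ≥ 1`.) -/
def IsReLUNetwork {k n : ℕ} (d : ℕ)
    (G : EuclideanSpace ℝ (Fin k) → EuclideanSpace ℝ (Fin n)) : Prop :=
  ∃ (l w : ℕ) (F : EuclideanSpace ℝ (Fin k) → EuclideanSpace ℝ (Fin w))
    (W : Matrix (Fin n) (Fin w) ℝ) (b : EuclideanSpace ℝ (Fin n)),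
    d = l + 1 ∧ HiddenLayers k n l w F ∧
      ((∀ z, G z = affineLayer W b (F z)) ∨ (∀ z, G z = relu (affineLayer W b (F z))))

/-- The random vector `a` has fourth moments, and
`(𝔼⟨a,u⟩⁴)^(1/4) ≤ C (𝔼⟨a,u⟩²)^(1/2)` for all `u`. -/
def IsHeavyTailed {Ω : Type*} [MeasurableSpace Ω] {n : ℕ} (C : ℝ)
    (a : Ω → EuclideanSpace ℝ (Fin n)) (P : Measure Ω) : Prop :=
  ∀ u : EuclideanSpace ℝ (Fin n),
    MemLp (fun ω => inner ℝ (a ω) u) 4 P ∧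
    (∫ ω, (inner ℝ (a ω) u) ^ 4 ∂P) ^ (1 / 4 : ℝ) ≤
      C * (∫ ω, (inner ℝ (a ω) u) ^ 2 ∂P) ^ (1 / 2 : ℝ)

/-- The random vector `a` is isotropic: `𝔼[a aᵀ]` exists and is the identity matrix. -/
def IsIsotropic {Ω : Type*} [MeasurableSpace Ω] {n : ℕ}
    (a : Ω → EuclideanSpace ℝ (Fin n)) (P : Measure Ω) : Prop :=
  ∀ i j : Fin n, Integrable (fun ω => a ω i * a ω j) P ∧
    ∫ ω, a ω i * a ω j ∂P = (1 : Matrix (Fin n) (Fin n) ℝ) i j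

/-- The `i`-th row of a random matrix, as a random vector in Euclidean space. -/
noncomputable def matrixRow {Ω : Type*} {m n : ℕ} (A : Ω → Matrix (Fin m) (Fin n) ℝ)
    (i : Fin m) (ω : Ω) : EuclideanSpace ℝ (Fin n) :=
  WithLp.toLp 2 (A ω i)

/-! A ReLU network is piecewise affine with few pieces: by Sauer–Shelah each layer multiplies their
number by at most `(n + 1) ^ (k + 1)`. Differences `G z₁ - G z₂` therefore lie in a union of at most
`((n + 1) ^ (k + 1)) ^ (2 * d)` subspaces of dimension at most `2 * k + 1`. It suffices to bound the
quadratic form of `A` from below on nets of their unit spheres.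

For a fixed direction, a sum of independent nonnegative variables has an exponential lower tail as
soon as second moments exist (`measureReal_sum_le_of_nonneg`), and fourth moments of the rows supply
these. Passing from the net to the sphere is the difficulty, since heavy tails give no exponentially
likely bound on `‖a i‖`. Each square is therefore replaced by zero where `‖a i‖ ^ 2` exceeds a
threshold of order `n ^ 2`. This only decreases the form, costs a small part of its mean, and makes
it deterministically stable in the direction (`truncatedSq_sub_le`). The net must then have
polynomially small mesh in `n`, which adds only `O(k log n)` to the log-cardinality, so the union
bound closes. -/

/-! ### Counting positivity patterns -/

lemma sum_choose_le_succ_pow (N v : ℕ) : ∑ j ∈ Finset.Iic v, N.choose j ≤ (N + 1) ^ v := by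
  rw [add_pow, Nat.range_succ_eq_Iic]
  refine Finset.sum_le_sum fun j hj => ?_
  rw [one_pow, mul_one]
  have h1 : 1 ≤ v.choose j := Nat.choose_pos (Finset.mem_Iic.1 hj)
  exact (Nat.choose_le_pow N j).trans (Nat.le_mul_of_pos_right _ h1)

/-- Dudley's bound: the positivity patterns of linear functionals on finitely many vectors of a
`v`-dimensional space shatter no set with more than `v` elements. -/
lemma card_le_finrank_of_shatters {ι U Z : Type*} [DecidableEq ι] [AddCommGroup U]
    [Module ℝ U] [FiniteDimensional ℝ U] (x : ι → U) (φ : Z → U →ₗ[ℝ] ℝ)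
    (𝒜 : Finset (Finset ι)) (h𝒜 : ∀ S ∈ 𝒜, ∃ z, ∀ i, i ∈ S ↔ 0 < φ z (x i)) {T : Finset ι}
    (hT : 𝒜.Shatters T) : T.card ≤ Module.finrank ℝ U := by
  by_contra! hlt
  have hdep : ¬ LinearIndependent ℝ (fun i : T => x i) := fun h => by
    have := h.fintype_card_le_finrank
    simp only [Fintype.card_coe] at this
    omega
  obtain ⟨g, hg, i₀, hi₀⟩ := Fintype.not_linearIndependent_iff.1 hdep
  obtain ⟨c, hc, hpos⟩ : ∃ c : T → ℝ, ∑ i, c i • x i = 0 ∧ 0 < c i₀ := by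
    rcases lt_or_gt_of_ne hi₀ with h | h
    · exact ⟨-g, by simp only [Pi.neg_apply, neg_smul, Finset.sum_neg_distrib, hg, neg_zero],
        by simpa using h⟩
    · exact ⟨g, hg, h⟩
  -- Shattering realizes the positive support of `c` as a pattern. Every term `c i * φ z (x i)` is
  -- then nonnegative and the one at `i₀` positive, although the sum vanishes.
  obtain ⟨S, hS, hTS⟩ := hT (t := (Finset.univ.filter fun i : T => 0 < c i).image Subtype.val)
    (fun i hi => by obtain ⟨j, -, rfl⟩ := Finset.mem_image.1 hi; exact j.2)
  obtain ⟨z, hz⟩ := h𝒜 S hS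
  have key : ∀ i : T, 0 < c i ↔ 0 < φ z (x i) := by
    intro i
    rw [← hz]
    have : (i : ι) ∈ T ∩ S ↔ 0 < c i := by rw [hTS]; simp
    simpa using this.symm
  have hsum : ∑ i : T, c i * φ z (x i) = 0 := by
    have := congrArg (φ z) hc
    simpa using this
  have hnn : ∀ i : T, 0 ≤ c i * φ z (x i) := fun i => by
    by_cases h : 0 < c i
    · exact (mul_pos h ((key i).1 h)).le
    · exact mul_nonneg_of_nonpos_of_nonpos (not_lt.1 h) (not_lt.1 fun h' => h ((key i).2 h'))
  have := (Finset.sum_eq_zero_iff_of_nonneg fun i _ => hnn i).1 hsum i₀ (Finset.mem_univ _)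
  exact (mul_pos hpos ((key i₀).1 hpos)).ne' this

/-- An affine map from `ℝᵏ` to `ℝʷ` has at most `(w + 1) ^ (k + 1)` positivity patterns. -/
lemma exists_finset_patterns {k w : ℕ}
    (L : EuclideanSpace ℝ (Fin k) →ᵃ[ℝ] EuclideanSpace ℝ (Fin w)) :
    ∃ 𝒜 : Finset (Finset (Fin w)), 𝒜.card ≤ (w + 1) ^ (k + 1) ∧
      ∀ z, ∃ S ∈ 𝒜, ∀ i, i ∈ S ↔ 0 < L z i := by
  classical
  let pat : EuclideanSpace ℝ (Fin k) → Finset (Fin w) := fun z => Finset.univ.filter (0 < L z ·)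
  let 𝒜 : Finset (Finset (Fin w)) := Finset.univ.filter fun S => ∃ z, pat z = S
  refine ⟨𝒜, ?_, fun z => ⟨pat z, by simp [𝒜], by simp [pat]⟩⟩
  have hvc : 𝒜.vcDim ≤ k + 1 := by
    refine Finset.sup_le fun T hT => ?_
    rw [Finset.mem_shatterer] at hT
    have hd : Module.finrank ℝ (ℝ × (EuclideanSpace ℝ (Fin k) →ₗ[ℝ] ℝ)) = k + 1 := by
      rw [Module.finrank_prod, Module.finrank_linearMap]
      simp [add_comm]
    rw [← hd]
    -- Each coordinate of `L` is an affine functional, that is, a constant and a linear form: a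
    -- vector in a space of dimension `k + 1`, on which evaluation at `z` is linear.
    refine card_le_finrank_of_shatters (Z := EuclideanSpace ℝ (Fin k))
      (fun i => (L 0 i, (EuclideanSpace.proj (𝕜 := ℝ) i).toLinearMap ∘ₗ L.linear))
      (fun z => LinearMap.coprod LinearMap.id (LinearMap.applyₗ z)) 𝒜 ?_ hT
    intro S hS
    obtain ⟨z, rfl⟩ := (Finset.mem_filter.1 hS).2
    refine ⟨z, fun i => ?_⟩
    have : L z = L.linear z + L 0 := by
      have := L.map_vadd 0 z
      simpa using this
    simp [pat, this, add_comm]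
  calc 𝒜.card ≤ ∑ j ∈ Finset.Iic 𝒜.vcDim, (Fintype.card (Fin w)).choose j :=
        𝒜.card_le_card_shatterer.trans Finset.card_shatterer_le_sum_vcDim
    _ ≤ ((Fintype.card (Fin w)) + 1) ^ 𝒜.vcDim := sum_choose_le_succ_pow _ _
    _ ≤ (w + 1) ^ (k + 1) := by
        rw [Fintype.card_fin]
        exact Nat.pow_le_pow_right (Nat.succ_pos _) hvc

/-! ### Affine pieces of a network -/

/-- `F` agrees at every point with one of at most `B` affine maps. -/
def HasAffinePieces {k w : ℕ} (B : ℕ)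
    (F : EuclideanSpace ℝ (Fin k) → EuclideanSpace ℝ (Fin w)) : Prop :=
  ∃ S : Finset (EuclideanSpace ℝ (Fin k) →ᵃ[ℝ] EuclideanSpace ℝ (Fin w)),
    S.card ≤ B ∧ ∀ z, ∃ L ∈ S, F z = L z

lemma HasAffinePieces.affineLayer {k w w' B : ℕ}
    {F : EuclideanSpace ℝ (Fin k) → EuclideanSpace ℝ (Fin w)} (hF : HasAffinePieces B F)
    (W : Matrix (Fin w') (Fin w) ℝ) (b : EuclideanSpace ℝ (Fin w')) :
    HasAffinePieces B (fun z => affineLayer W b (F z)) := by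
  classical
  obtain ⟨S, hS, h⟩ := hF
  refine ⟨S.image fun L => W.toEuclideanLin.toAffineMap.comp L + AffineMap.const ℝ _ b,
    Finset.card_image_le.trans hS, fun z => ?_⟩
  obtain ⟨L, hL, e⟩ := h z
  exact ⟨_, Finset.mem_image_of_mem _ hL, by simp [_root_.affineLayer, e]⟩

/-- Where an affine piece has a fixed positivity pattern, ReLU acts on it as a coordinate
projection, so each piece splits into at most one per pattern. -/
lemma HasAffinePieces.relu {k w B : ℕ}
    {F : EuclideanSpace ℝ (Fin k) → EuclideanSpace ℝ (Fin w)} (hF : HasAffinePieces B F) :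
    HasAffinePieces (B * (w + 1) ^ (k + 1)) (fun z => relu (F z)) := by
  classical
  obtain ⟨S, hS, h⟩ := hF
  choose 𝒜 h𝒜 hpat using fun L : EuclideanSpace ℝ (Fin k) →ᵃ[ℝ] EuclideanSpace ℝ (Fin w) =>
    exists_finset_patterns L
  let proj : Finset (Fin w) → EuclideanSpace ℝ (Fin w) →ₗ[ℝ] EuclideanSpace ℝ (Fin w) :=
    fun T => (Matrix.diagonal fun i => if i ∈ T then (1 : ℝ) else 0).toEuclideanLin
  refine ⟨S.biUnion fun L => (𝒜 L).image fun T => (proj T).toAffineMap.comp L, ?_, fun z => ?_⟩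
  · refine (Finset.card_biUnion_le_card_mul _ _ _ fun L _ =>
      Finset.card_image_le.trans (h𝒜 L)).trans (Nat.mul_le_mul_right _ hS)
  · obtain ⟨L, hL, e⟩ := h z
    obtain ⟨T, hT, hTz⟩ := hpat L z
    refine ⟨_, Finset.mem_biUnion.2 ⟨L, hL, Finset.mem_image_of_mem _ hT⟩, ?_⟩
    ext i
    have hi := hTz i
    by_cases hiT : i ∈ T
    · simp [_root_.relu, e, proj, Matrix.toLpLin_apply, Matrix.mulVec_diagonal, hiT,
        (hi.1 hiT).le]
    · have : L z i ≤ 0 := not_lt.1 fun h' => hiT (hi.2 h')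
      simp [_root_.relu, e, proj, Matrix.toLpLin_apply, Matrix.mulVec_diagonal, hiT, this]

lemma HasAffinePieces.mono {k w B B' : ℕ}
    {F : EuclideanSpace ℝ (Fin k) → EuclideanSpace ℝ (Fin w)} (hF : HasAffinePieces B F)
    (h : B ≤ B') : HasAffinePieces B' F :=
  let ⟨S, hS, hz⟩ := hF
  ⟨S, hS.trans h, hz⟩

lemma HiddenLayers.hasAffinePieces {k N l w : ℕ}
    {F : EuclideanSpace ℝ (Fin k) → EuclideanSpace ℝ (Fin w)} (hF : HiddenLayers k N l w F) :
    HasAffinePieces (((N + 1) ^ (k + 1)) ^ l) F := by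
  induction hF with
  | input => exact ⟨{AffineMap.id ℝ _}, by simp, fun z => ⟨_, Finset.mem_singleton_self _, rfl⟩⟩
  | layer hF hw' W b ih =>
    refine ((ih.affineLayer W b).relu).mono ?_
    rw [pow_succ]
    exact Nat.mul_le_mul_left _ (Nat.pow_le_pow_left (Nat.succ_le_succ hw') _)

lemma IsReLUNetwork.hasAffinePieces {k n d : ℕ}
    {G : EuclideanSpace ℝ (Fin k) → EuclideanSpace ℝ (Fin n)} (hG : IsReLUNetwork d G) :
    1 ≤ d ∧ HasAffinePieces (((n + 1) ^ (k + 1)) ^ d) G := by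
  obtain ⟨l, w, F, W, b, rfl, hF, h | h⟩ := hG
  · obtain rfl : G = _ := funext h
    exact ⟨by omega, (hF.hasAffinePieces.affineLayer W b).mono
      (Nat.pow_le_pow_right (by positivity) (by omega))⟩
  · obtain rfl : G = _ := funext h
    exact ⟨by omega, by simpa only [pow_succ] using (hF.hasAffinePieces.affineLayer W b).relu⟩

/-! ### Lower tails of nonnegative sums -/

/-- Follows from `(1 - x + x²/2)(1 + x + x²/2) = 1 + x⁴/4 ≥ 1`. -/
lemma Real.exp_neg_le_quadratic {x : ℝ} (hx : 0 ≤ x) : Real.exp (-x) ≤ 1 - x + x ^ 2 / 2 := by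
  have h := Real.quadratic_le_exp_of_nonneg hx
  have hp : 0 < 1 - x + x ^ 2 / 2 := by nlinarith [sq_nonneg (x - 1)]
  have h4 : 0 ≤ x ^ 4 := by positivity
  rw [Real.exp_neg, inv_le_iff_one_le_mul₀ (Real.exp_pos x)]
  nlinarith [mul_le_mul_of_nonneg_left h hp.le]

section LowerTail

variable {Ω : Type*} [MeasurableSpace Ω] {P : Measure Ω} [IsProbabilityMeasure P]

lemma integrable_exp_neg_mul_of_nonneg {X : Ω → ℝ} (hX : Measurable X) (h0 : ∀ ω, 0 ≤ X ω)
    {t : ℝ} (ht : 0 ≤ t) : Integrable (fun ω => Real.exp (-t * X ω)) P := by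
  refine Integrable.of_bound (C := 1) (by fun_prop) (ae_of_all _ fun ω => ?_)
  rw [Real.norm_of_nonneg (Real.exp_pos _).le, Real.exp_le_one_iff]
  nlinarith [mul_nonneg ht (h0 ω)]

lemma mgf_neg_le_of_nonneg {X : Ω → ℝ} (hX : Measurable X) (h0 : ∀ ω, 0 ≤ X ω)
    (h1 : Integrable X P) (h2 : Integrable (fun ω => X ω ^ 2) P) {μ D : ℝ}
    (hμ : μ ≤ ∫ ω, X ω ∂P) (hD : ∫ ω, X ω ^ 2 ∂P ≤ D) {t : ℝ} (ht : 0 ≤ t) :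
    mgf X P (-t) ≤ Real.exp (-(t * μ) + t ^ 2 * D / 2) := by
  have hint : Integrable (fun ω => 1 - t * X ω + t ^ 2 / 2 * X ω ^ 2) P :=
    ((integrable_const 1).sub (h1.const_mul t)).add (h2.const_mul _)
  calc mgf X P (-t) ≤ ∫ ω, (1 - t * X ω + t ^ 2 / 2 * X ω ^ 2) ∂P := by
        refine integral_mono (integrable_exp_neg_mul_of_nonneg hX h0 ht) hint fun ω => ?_
        have := Real.exp_neg_le_quadratic (mul_nonneg ht (h0 ω))
        simp only [neg_mul]
        linarith [mul_pow t (X ω) 2]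
    _ = 1 - t * ∫ ω, X ω ∂P + t ^ 2 / 2 * ∫ ω, X ω ^ 2 ∂P := by
        have hs : Integrable (fun ω => 1 - t * X ω) P := (integrable_const 1).sub (h1.const_mul t)
        rw [integral_add hs (h2.const_mul _),
          integral_sub (integrable_const 1) (h1.const_mul t), integral_const_mul,
          integral_const_mul]
        simp
    _ ≤ -(t * μ) + t ^ 2 * D / 2 + 1 := by
        nlinarith [mul_le_mul_of_nonneg_left hμ ht, mul_le_mul_of_nonneg_left hD (sq_nonneg t)]
    _ ≤ _ := Real.add_one_le_exp _

/-- Lower tail of a sum of independent nonnegative random variables with second moments. -/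
lemma measureReal_sum_le_of_nonneg {m : ℕ} {X : Fin m → Ω → ℝ} (hind : iIndepFun X P)
    (hX : ∀ i, Measurable (X i)) (h0 : ∀ i ω, 0 ≤ X i ω)
    (h1 : ∀ i, Integrable (X i) P) (h2 : ∀ i, Integrable (fun ω => X i ω ^ 2) P) {μ D : ℝ}
    (hμ : ∀ i, μ ≤ ∫ ω, X i ω ∂P) (hD : ∀ i, ∫ ω, X i ω ^ 2 ∂P ≤ D) {t : ℝ} (ht : 0 ≤ t)
    (s : ℝ) :
    P.real {ω | ∑ i, X i ω ≤ m * s} ≤ Real.exp (m * (t * s - t * μ + t ^ 2 * D / 2)) := by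
  have hset : {ω | ∑ i, X i ω ≤ m * s} = {ω | (∑ i, X i) ω ≤ m * s} := by
    ext ω; simp
  have hexp : Integrable (fun ω => Real.exp (-t * (∑ i, X i) ω)) P := by
    refine integrable_exp_neg_mul_of_nonneg (by fun_prop) (fun ω => ?_) ht
    rw [Finset.sum_apply]
    exact Finset.sum_nonneg fun i _ => h0 i ω
  rw [hset]
  refine (measure_le_le_exp_mul_mgf _ (neg_nonpos.2 ht) hexp).trans ?_
  rw [hind.mgf_sum hX]
  calc _ ≤ Real.exp (- -t * (m * s)) *
        ∏ _i : Fin m, Real.exp (-(t * μ) + t ^ 2 * D / 2) := by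
        gcongr with i
        · exact fun i _ => mgf_nonneg
        · exact mgf_neg_le_of_nonneg (hX i) (h0 i) (h1 i) (h2 i) (hμ i) (hD i) ht
    _ = _ := by
        rw [Finset.prod_const, Finset.card_univ, Fintype.card_fin, ← Real.exp_nat_mul,
          ← Real.exp_add]
        congr 1
        ring

end LowerTail

/-! ### Moments and truncation of the rows -/

section Moments

variable {Ω : Type*} [MeasurableSpace Ω] {P : Measure Ω} {n : ℕ}
  {a : Ω → EuclideanSpace ℝ (Fin n)} {C : ℝ}

lemma IsIsotropic.integral_inner_sq (h : IsIsotropic a P) (u : EuclideanSpace ℝ (Fin n)) :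
    ∫ ω, (inner ℝ (a ω) u) ^ 2 ∂P = ‖u‖ ^ 2 := by
  have hexp : ∀ ω, (inner ℝ (a ω) u) ^ 2 = ∑ i, ∑ j, (u i * u j) * (a ω i * a ω j) := by
    intro ω
    rw [PiLp.inner_apply, sq, Finset.sum_mul_sum]
    refine Finset.sum_congr rfl fun i _ => Finset.sum_congr rfl fun j _ => ?_
    simp only [RCLike.inner_apply, conj_trivial]
    ring
  simp_rw [hexp]
  rw [integral_finsetSum _ fun i _ => integrable_finsetSum _ fun j _ => (h i j).1.const_mul _]
  simp_rw [integral_finsetSum _ fun j _ => (h _ j).1.const_mul _, integral_const_mul,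
    fun i j => (h i j).2, Matrix.one_apply]
  simp [EuclideanSpace.real_norm_sq_eq, ← sq]

lemma IsHeavyTailed.integrable_inner_pow_four (h : IsHeavyTailed C a P)
    (u : EuclideanSpace ℝ (Fin n)) : Integrable (fun ω => (inner ℝ (a ω) u) ^ 4) P := by
  have := (h u).1.integrable_norm_pow (p := 4) (by norm_num)
  simpa [Even.pow_abs (by decide : Even 4)] using this

lemma IsHeavyTailed.integrable_inner_sq [IsProbabilityMeasure P] (h : IsHeavyTailed C a P)
    (u : EuclideanSpace ℝ (Fin n)) : Integrable (fun ω => (inner ℝ (a ω) u) ^ 2) P :=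
  ((h u).1.mono_exponent (by norm_num)).integrable_sq

lemma IsHeavyTailed.integral_inner_pow_four_le (h : IsHeavyTailed C a P) (hi : IsIsotropic a P)
    (u : EuclideanSpace ℝ (Fin n)) :
    ∫ ω, (inner ℝ (a ω) u) ^ 4 ∂P ≤ C ^ 4 * ‖u‖ ^ 4 := by
  have h2 := (h u).2
  rw [hi.integral_inner_sq, ← Real.sqrt_eq_rpow, Real.sqrt_sq (norm_nonneg u)] at h2
  have h0 : 0 ≤ ∫ ω, (inner ℝ (a ω) u) ^ 4 ∂P := integral_nonneg fun ω => by positivity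
  have := pow_le_pow_left₀ (Real.rpow_nonneg h0 _) h2 4
  rw [← Real.rpow_natCast, ← Real.rpow_mul h0] at this
  norm_num at this
  rwa [mul_pow] at this

/-- The square `⟨a, u⟩²`, replaced by zero where `‖a‖² > h`. -/
noncomputable def truncatedSq (h : ℝ) (u a : EuclideanSpace ℝ (Fin n)) : ℝ :=
  if ‖a‖ ^ 2 ≤ h then (inner ℝ a u) ^ 2 else 0

lemma measurable_truncatedSq (h : ℝ) (u : EuclideanSpace ℝ (Fin n)) :
    Measurable (truncatedSq h u) :=
  Measurable.ite (measurableSet_le (by fun_prop) measurable_const) (by fun_prop) measurable_const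

lemma truncatedSq_nonneg (h : ℝ) (u x : EuclideanSpace ℝ (Fin n)) : 0 ≤ truncatedSq h u x := by
  unfold truncatedSq
  split_ifs <;> positivity

lemma truncatedSq_le (h : ℝ) (u x : EuclideanSpace ℝ (Fin n)) :
    truncatedSq h u x ≤ (inner ℝ x u) ^ 2 := by
  unfold truncatedSq
  split_ifs
  · rfl
  · positivity

/-- Cauchy–Schwarz over the coordinates; it reduces the fourth moment of the norm to one-dimensional
ones. -/
lemma norm_pow_four_le (x : EuclideanSpace ℝ (Fin n)) :
    ‖x‖ ^ 4 ≤ n * ∑ j, (inner ℝ x (EuclideanSpace.single j (1 : ℝ))) ^ 4 := by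
  have h := sq_sum_le_card_mul_sum_sq (s := Finset.univ) (f := fun j => x j ^ 2)
  have e : ‖x‖ ^ 4 = (∑ j, x j ^ 2) ^ 2 := by
    rw [← EuclideanSpace.real_norm_sq_eq]; ring
  rw [e]
  refine h.trans (le_of_eq ?_)
  simp only [Finset.card_univ, Fintype.card_fin, ← pow_mul]
  congr 1
  refine Finset.sum_congr rfl fun j _ => ?_
  simp [EuclideanSpace.inner_single_right]

/-- A pointwise Markov bound: where truncation acts, `‖x‖ ^ 2 ≤ ‖x‖ ^ 4 / h` controls the loss. -/
lemma le_truncatedSq {h : ℝ} (hh : 0 < h) (u x : EuclideanSpace ℝ (Fin n)) :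
    (inner ℝ x u) ^ 2 - ‖u‖ ^ 2 * n / h * ∑ j, (inner ℝ x (EuclideanSpace.single j (1 : ℝ))) ^ 4
      ≤ truncatedSq h u x := by
  by_cases hx : ‖x‖ ^ 2 ≤ h
  · have e : truncatedSq h u x = (inner ℝ x u) ^ 2 := if_pos hx
    rw [e, sub_le_self_iff]
    exact mul_nonneg (by positivity) (Finset.sum_nonneg fun j _ => by positivity)
  · refine le_trans ?_ (truncatedSq_nonneg h u x)
    rw [sub_nonpos]
    have h1 : (inner ℝ x u) ^ 2 ≤ ‖x‖ ^ 2 * ‖u‖ ^ 2 := by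
      rw [← mul_pow, sq_le_sq, abs_of_nonneg (mul_nonneg (norm_nonneg x) (norm_nonneg u))]
      exact abs_real_inner_le_norm x u
    have h2 : ‖x‖ ^ 2 ≤ ‖x‖ ^ 4 / h := by
      rw [le_div_iff₀ hh]
      nlinarith [sq_nonneg ‖x‖]
    calc (inner ℝ x u) ^ 2 ≤ ‖x‖ ^ 4 / h * ‖u‖ ^ 2 := h1.trans (by gcongr)
      _ ≤ (n * ∑ j, (inner ℝ x (EuclideanSpace.single j (1 : ℝ))) ^ 4) / h * ‖u‖ ^ 2 := by
          gcongr; exact norm_pow_four_le x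
      _ = _ := by ring

lemma IsHeavyTailed.integrable_truncatedSq [IsProbabilityMeasure P] (ht : IsHeavyTailed C a P) (ha : Measurable a) (h : ℝ)
    (u : EuclideanSpace ℝ (Fin n)) : Integrable (fun ω => truncatedSq h u (a ω)) P := by
  refine (ht.integrable_inner_sq u).mono'
    ((measurable_truncatedSq h u).comp ha).aestronglyMeasurable (ae_of_all _ fun ω => ?_)
  rw [Real.norm_of_nonneg (truncatedSq_nonneg _ _ _)]
  exact truncatedSq_le _ _ _

lemma truncatedSq_sq_le (h : ℝ) (u x : EuclideanSpace ℝ (Fin n)) :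
    truncatedSq h u x ^ 2 ≤ (inner ℝ x u) ^ 4 := by
  calc _ ≤ ((inner ℝ x u) ^ 2) ^ 2 :=
        pow_le_pow_left₀ (truncatedSq_nonneg _ _ _) (truncatedSq_le _ _ _) 2
    _ = _ := by ring

lemma IsHeavyTailed.integrable_truncatedSq_sq (ht : IsHeavyTailed C a P) (ha : Measurable a)
    (h : ℝ) (u : EuclideanSpace ℝ (Fin n)) :
    Integrable (fun ω => truncatedSq h u (a ω) ^ 2) P := by
  refine (ht.integrable_inner_pow_four u).mono'
    (((measurable_truncatedSq h u).comp ha).pow_const 2).aestronglyMeasurable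
    (ae_of_all _ fun ω => ?_)
  rw [Real.norm_of_nonneg (sq_nonneg _)]
  exact truncatedSq_sq_le _ _ _

lemma IsHeavyTailed.integral_truncatedSq_sq_le (ht : IsHeavyTailed C a P) (hi : IsIsotropic a P)
    (ha : Measurable a) (h : ℝ) (u : EuclideanSpace ℝ (Fin n)) :
    ∫ ω, truncatedSq h u (a ω) ^ 2 ∂P ≤ C ^ 4 * ‖u‖ ^ 4 :=
  (integral_mono (ht.integrable_truncatedSq_sq ha h u) (ht.integrable_inner_pow_four u)
    fun _ => truncatedSq_sq_le _ _ _).trans (ht.integral_inner_pow_four_le hi u)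

lemma IsHeavyTailed.le_integral_truncatedSq [IsProbabilityMeasure P] (ht : IsHeavyTailed C a P) (hi : IsIsotropic a P)
    (ha : Measurable a) {h : ℝ} (hh : 0 < h) (u : EuclideanSpace ℝ (Fin n)) :
    ‖u‖ ^ 2 * (1 - C ^ 4 * n ^ 2 / h) ≤ ∫ ω, truncatedSq h u (a ω) ∂P := by
  have h4 : ∀ j, Integrable
      (fun ω => (inner ℝ (a ω) (EuclideanSpace.single j (1 : ℝ))) ^ 4) P :=
    fun j => ht.integrable_inner_pow_four _
  have hS := integrable_finsetSum Finset.univ fun j _ => h4 j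
  have hle := integral_mono ((ht.integrable_inner_sq u).sub (hS.const_mul (‖u‖ ^ 2 * n / h)))
    (ht.integrable_truncatedSq ha h u) fun ω => le_truncatedSq hh u (a ω)
  refine le_trans ?_ hle
  simp only [Pi.sub_apply]
  rw [integral_sub (ht.integrable_inner_sq u) (hS.const_mul _), hi.integral_inner_sq,
    integral_const_mul, integral_finsetSum _ fun j _ => h4 j]
  have hsum : ∑ j, ∫ ω, (inner ℝ (a ω) (EuclideanSpace.single j (1 : ℝ))) ^ 4 ∂P ≤ n * C ^ 4 := by
    refine (Finset.sum_le_sum fun j _ => ht.integral_inner_pow_four_le hi _).trans ?_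
    simp
  have := mul_le_mul_of_nonneg_left hsum (by positivity : 0 ≤ ‖u‖ ^ 2 * n / h)
  calc _ = ‖u‖ ^ 2 - ‖u‖ ^ 2 * n / h * (n * C ^ 4) := by ring
    _ ≤ _ := by linarith

/-- Stability of the truncated square under a perturbation of the direction. -/
lemma truncatedSq_sub_le {h δ : ℝ} (hh : 0 ≤ h) (hδ : δ ≤ 1) {u v : EuclideanSpace ℝ (Fin n)}
    (hv : ‖v‖ = 1) (huv : ‖v - u‖ ≤ δ) (x : EuclideanSpace ℝ (Fin n)) :
    truncatedSq h u x - 3 * δ * h ≤ truncatedSq h v x := by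
  have hδ0 : 0 ≤ δ := (norm_nonneg _).trans huv
  unfold truncatedSq
  split_ifs with hx
  -- The cutoff depends on `x` alone, so both squares survive together. Their difference factors as
  -- `⟨x, v - u⟩⟨x, u + v⟩`, with `‖u + v‖ ≤ 2 + δ ≤ 3`.
  · have h1 : |inner ℝ x (v - u)| ≤ ‖x‖ * δ :=
      (abs_real_inner_le_norm _ _).trans (by gcongr)
    have h2 : |inner ℝ x (u + v)| ≤ ‖x‖ * 3 := by
      refine (abs_real_inner_le_norm _ _).trans ?_
      gcongr
      have : u + v = (2 : ℝ) • v - (v - u) := by module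
      rw [this]
      refine (norm_sub_le _ _).trans ?_
      rw [norm_smul, hv]
      norm_num
      linarith
    have h3 : |inner ℝ x (v - u) * inner ℝ x (u + v)| ≤ 3 * δ * h := by
      rw [abs_mul]
      calc _ ≤ (‖x‖ * δ) * (‖x‖ * 3) := by gcongr
        _ = 3 * δ * ‖x‖ ^ 2 := by ring
        _ ≤ _ := by gcongr
    have h4 := (abs_le.1 h3).1
    rw [inner_sub_right, inner_add_right] at h4
    nlinarith
  · simp only [zero_sub, Left.neg_nonpos_iff]
    positivity

end Moments

/-! ### Grid nets -/

/-- The unit sphere of a subspace has a net of grid points. -/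
lemma exists_grid_net {n : ℕ} (V : Submodule ℝ (EuclideanSpace ℝ (Fin n))) {M : ℕ} (hM : 0 < M) :
    ∃ N : Finset (EuclideanSpace ℝ (Fin n)), N.card ≤ (2 * M + 1) ^ Module.finrank ℝ V ∧
      ∀ v ∈ V, ‖v‖ = 1 → ∃ u ∈ N, ‖v - u‖ ≤ Module.finrank ℝ V / M := by
  classical
  have hM' : (0 : ℝ) < M := by exact_mod_cast hM
  let b := stdOrthonormalBasis ℝ V
  let pt : (Fin (Module.finrank ℝ V) → ℤ) → EuclideanSpace ℝ (Fin n) :=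
    fun q => ∑ j, ((q j : ℝ) / M) • (b j : EuclideanSpace ℝ (Fin n))
  refine ⟨(Fintype.piFinset fun _ => Finset.Icc (-(M : ℤ)) M).image pt, ?_, fun v hv hv1 => ?_⟩
  · refine Finset.card_image_le.trans (le_of_eq ?_)
    rw [Fintype.card_piFinset_const, Int.card_Icc]
    congr 1
    omega
  · let c : Fin (Module.finrank ℝ V) → ℝ := fun j => b.repr ⟨v, hv⟩ j
    have hc : ∀ j, |c j| ≤ 1 := fun j => by
      have := PiLp.norm_apply_le (b.repr ⟨v, hv⟩) j
      rw [LinearIsometryEquiv.norm_map] at this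
      simpa [hv1, c] using this
    have hsum : v = ∑ j, c j • (b j : EuclideanSpace ℝ (Fin n)) := by
      have := congrArg Subtype.val (b.sum_repr ⟨v, hv⟩)
      simpa [c] using this.symm
    -- Rounding down each orthonormal coordinate costs at most `1 / M`; the triangle inequality adds
    -- these errors.
    refine ⟨pt fun j => ⌊c j * M⌋, Finset.mem_image_of_mem _ (Fintype.mem_piFinset.2 fun j => ?_), ?_⟩
    · obtain ⟨h1, h2⟩ := abs_le.1 (hc j)
      rw [Finset.mem_Icc]
      constructor
      · rw [Int.le_floor]
        push_cast
        nlinarith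
      · have : (⌊c j * M⌋ : ℝ) ≤ (M : ℤ) := (Int.floor_le _).trans (by push_cast; nlinarith)
        exact_mod_cast this
    · have hdiff : v - pt (fun j => ⌊c j * M⌋) =
          ∑ j, (c j - (⌊c j * M⌋ : ℝ) / M) • (b j : EuclideanSpace ℝ (Fin n)) := by
        simp only [sub_smul, Finset.sum_sub_distrib, ← hsum, pt]
      rw [hdiff]
      calc _ ≤ ∑ _j : Fin (Module.finrank ℝ V), 1 / (M : ℝ) := by
            refine norm_sum_le_of_le _ fun j _ => ?_
            have hb : ‖(b j : EuclideanSpace ℝ (Fin n))‖ = 1 := b.orthonormal.1 j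
            rw [norm_smul, hb, mul_one, Real.norm_eq_abs]
            have e : c j - (⌊c j * M⌋ : ℝ) / M = Int.fract (c j * M) / M := by
              rw [← Int.self_sub_floor]
              field_simp
            rw [e, abs_of_nonneg (div_nonneg (Int.fract_nonneg _) hM'.le)]
            gcongr
            exact (Int.fract_lt_one _).le
        _ = _ := by simp [div_eq_mul_inv]

/-! ### Lower isometry on a net and beyond -/

section LowerIsometry

variable {Ω : Type*} [MeasurableSpace Ω] {P : Measure Ω} [IsProbabilityMeasure P] {m n : ℕ}
  {a : Fin m → Ω → EuclideanSpace ℝ (Fin n)} {C τ : ℝ}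

lemma measureReal_sum_truncatedSq_le (hC : 0 < C) (hτ : 0 < τ) (hmeas : ∀ i, Measurable (a i))
    (hind : iIndepFun a P) (hi : ∀ i, IsIsotropic (a i) P) (ht : ∀ i, IsHeavyTailed C (a i) P)
    {u : EuclideanSpace ℝ (Fin n)} (hu : u ≠ 0) :
    P.real {ω | ∑ i, truncatedSq (4 * C ^ 4 * n ^ 2 / τ) u (a i ω) ≤
      m * ((1 - τ / 2) * ‖u‖ ^ 2)} ≤ Real.exp (-(τ ^ 2 / (32 * C ^ 4) * m)) := by
  have hn : (0 : ℝ) < n := by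
    rcases n.eq_zero_or_pos with rfl | h
    · exact absurd (Subsingleton.elim u 0) hu
    · exact_mod_cast h
  have hu0 : 0 < ‖u‖ := norm_pos_iff.2 hu
  have hh : 0 < 4 * C ^ 4 * n ^ 2 / τ := by positivity
  -- The threshold is chosen so that truncation loses a fraction `τ / 4` of the mean; the other `τ /
  -- 4` is left for the deviation.
  have hbias : C ^ 4 * n ^ 2 / (4 * C ^ 4 * n ^ 2 / τ) = τ / 4 := by field_simp
  have key := measureReal_sum_le_of_nonneg (P := P)
    (X := fun i ω => truncatedSq (4 * C ^ 4 * n ^ 2 / τ) u (a i ω))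
    (hind.comp _ fun _ => measurable_truncatedSq _ u)
    (fun i => (measurable_truncatedSq _ u).comp (hmeas i)) (fun _ _ => truncatedSq_nonneg _ _ _)
    (fun i => (ht i).integrable_truncatedSq (hmeas i) _ u)
    (fun i => (ht i).integrable_truncatedSq_sq (hmeas i) _ u)
    (fun i => (ht i).le_integral_truncatedSq (hi i) (hmeas i) hh u)
    (fun i => (ht i).integral_truncatedSq_sq_le (hi i) (hmeas i) _ u)
    -- This `t` minimizes `-t * (τ / 4) * ‖u‖ ^ 2 + t ^ 2 * C ^ 4 * ‖u‖ ^ 4 / 2`.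
    (t := τ / (4 * C ^ 4 * ‖u‖ ^ 2)) (by positivity) ((1 - τ / 2) * ‖u‖ ^ 2)
  refine key.trans (le_of_eq ?_)
  rw [hbias]
  congr 1
  field_simp
  ring

/-- Lower isometry, simultaneously on a set `D` whose directions are covered by a finite net. -/
lemma le_measureReal_forall_mem_of_net (hC : 0 < C) (hτ : 0 < τ) (hτ1 : τ ≤ 1) (hm : 0 < m)
    (hmeas : ∀ i, Measurable (a i)) (hind : iIndepFun a P) (hi : ∀ i, IsIsotropic (a i) P)
    (ht : ∀ i, IsHeavyTailed C (a i) P) {δ : ℝ} (hδ1 : δ < 1)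
    (hδ : 2 * δ + 3 * δ * (4 * C ^ 4 * n ^ 2 / τ) ≤ τ / 2)
    (N : Finset (EuclideanSpace ℝ (Fin n))) (D : Set (EuclideanSpace ℝ (Fin n)))
    (hD : ∀ x ∈ D, x ≠ 0 → ∃ r : ℝ, ∃ v, x = r • v ∧ ‖v‖ = 1 ∧ ∃ u ∈ N, ‖v - u‖ ≤ δ) :
    1 - N.card * Real.exp (-(τ ^ 2 / (32 * C ^ 4) * m)) ≤
      P.real {ω | ∀ x ∈ D, (1 - τ) * ‖x‖ ^ 2 ≤ 1 / (m : ℝ) * ∑ i, (inner ℝ (a i ω) x) ^ 2} := by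
  classical
  set h : ℝ := 4 * C ^ 4 * n ^ 2 / τ with hh
  have hh0 : 0 ≤ h := by positivity
  have hm' : (0 : ℝ) < m := by exact_mod_cast hm
  let bad : EuclideanSpace ℝ (Fin n) → Set Ω := fun u =>
    {ω | ∑ i, truncatedSq h u (a i ω) ≤ m * ((1 - τ / 2) * ‖u‖ ^ 2)}
  have hbadm : ∀ u, MeasurableSet (bad u) := fun u =>
    measurableSet_le (Finset.measurable_sum _ fun i _ =>
      (measurable_truncatedSq h u).comp (hmeas i)) measurable_const
  -- For `u = 0` the bad event is all of `Ω`, so zero is discarded; `δ < 1` keeps the net points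
  -- that are used away from it.
  have hU : MeasurableSet (⋃ u ∈ N.erase 0, bad u) :=
    Finset.measurableSet_biUnion _ fun u _ => hbadm u
  have hsub : (⋃ u ∈ N.erase 0, bad u)ᶜ ⊆
      {ω | ∀ x ∈ D, (1 - τ) * ‖x‖ ^ 2 ≤ 1 / (m : ℝ) * ∑ i, (inner ℝ (a i ω) x) ^ 2} := by
    intro ω hω x hx
    rcases eq_or_ne x 0 with rfl | hx0
    · simp
    obtain ⟨r, v, rfl, hv, u, huN, huv⟩ := hD x hx hx0
    have hδ0 : 0 ≤ δ := (norm_nonneg _).trans huv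
    have hunorm : 1 - δ ≤ ‖u‖ := by
      have := norm_sub_norm_le v u
      rw [hv] at this
      linarith
    have hu0 : u ≠ 0 := fun h0 => by rw [h0, norm_zero] at hunorm; linarith
    have hgood : m * ((1 - τ / 2) * ‖u‖ ^ 2) < ∑ i, truncatedSq h u (a i ω) := by
      by_contra! hcon
      exact hω (Set.mem_biUnion (Finset.mem_erase.2 ⟨hu0, huN⟩) hcon)
    have hstab : ∑ i, truncatedSq h u (a i ω) - m * (3 * δ * h) ≤
        ∑ i, (inner ℝ (a i ω) v) ^ 2 := by
      calc _ = ∑ i, (truncatedSq h u (a i ω) - 3 * δ * h) := by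
            rw [Finset.sum_sub_distrib]; simp
        _ ≤ _ := Finset.sum_le_sum fun i _ =>
            (truncatedSq_sub_le hh0 hδ1.le hv huv _).trans (truncatedSq_le _ _ _)
    have hsq : 1 - 2 * δ ≤ ‖u‖ ^ 2 := by nlinarith
    have hmain : m * (1 - τ) ≤ ∑ i, (inner ℝ (a i ω) v) ^ 2 := by
      -- Half of the loss `τ` was spent at the net point; `hδ` fits the change of norm and the
      -- stability error into the other half.
      have : 1 - τ ≤ (1 - τ / 2) * ‖u‖ ^ 2 - 3 * δ * h := by nlinarith
      nlinarith
    have e : ∑ i, (inner ℝ (a i ω) (r • v)) ^ 2 = r ^ 2 * ∑ i, (inner ℝ (a i ω) v) ^ 2 := by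
      simp only [inner_smul_right, mul_pow, Finset.mul_sum]
    rw [e, norm_smul, hv, mul_one, Real.norm_eq_abs, sq_abs, div_mul_eq_mul_div, one_mul,
      le_div_iff₀ hm']
    nlinarith [mul_le_mul_of_nonneg_left hmain (sq_nonneg r)]
  refine le_trans ?_ (measureReal_mono hsub)
  rw [probReal_compl_eq_one_sub hU, sub_le_sub_iff_left]
  calc _ ≤ ∑ u ∈ N.erase 0, P.real (bad u) := measureReal_biUnion_finset_le _ _
    _ ≤ ∑ _u ∈ N.erase 0, Real.exp (-(τ ^ 2 / (32 * C ^ 4) * m)) :=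
        Finset.sum_le_sum fun u hu => measureReal_sum_truncatedSq_le hC hτ hmeas hind hi ht
          (Finset.ne_of_mem_erase hu)
    _ ≤ _ := by
        rw [Finset.sum_const, nsmul_eq_mul]
        gcongr
        exact Finset.erase_subset _ _

end LowerIsometry

/-! ### A net for the differences of the network -/

/-- The differences of a map with few affine pieces have their directions near a small net. -/
lemma HasAffinePieces.exists_net {k n B M : ℕ}
    {G : EuclideanSpace ℝ (Fin k) → EuclideanSpace ℝ (Fin n)} (hG : HasAffinePieces B G)
    (hM : 0 < M) :
    ∃ N : Finset (EuclideanSpace ℝ (Fin n)), N.card ≤ B ^ 2 * (2 * M + 1) ^ (2 * k + 1) ∧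
      ∀ z₁ z₂, G z₁ - G z₂ ≠ 0 → ∃ r : ℝ, ∃ v, G z₁ - G z₂ = r • v ∧ ‖v‖ = 1 ∧
        ∃ u ∈ N, ‖v - u‖ ≤ n / M := by
  classical
  obtain ⟨S, hS, hz⟩ := hG
  -- Differences of values of two affine pieces lie in the sum of both linear ranges and the line of
  -- the offset: dimension at most `k + k + 1`.
  let V : (EuclideanSpace ℝ (Fin k) →ᵃ[ℝ] EuclideanSpace ℝ (Fin n)) ×
      (EuclideanSpace ℝ (Fin k) →ᵃ[ℝ] EuclideanSpace ℝ (Fin n)) →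
      Submodule ℝ (EuclideanSpace ℝ (Fin n)) := fun L =>
    (LinearMap.range L.1.linear ⊔ LinearMap.range L.2.linear) ⊔ ℝ ∙ (L.1 0 - L.2 0)
  have hV : ∀ L, Module.finrank ℝ (V L) ≤ 2 * k + 1 := fun L => by
    have h1 := Submodule.finrank_add_le_finrank_add_finrank
      (LinearMap.range L.1.linear) (LinearMap.range L.2.linear)
    have h2 := Submodule.finrank_add_le_finrank_add_finrank
      (LinearMap.range L.1.linear ⊔ LinearMap.range L.2.linear) (ℝ ∙ (L.1 0 - L.2 0))
    have h3 := L.1.linear.finrank_range_le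
    have h4 := L.2.linear.finrank_range_le
    have h5 := finrank_span_le_card (R := ℝ) ({L.1 0 - L.2 0} : Set (EuclideanSpace ℝ (Fin n)))
    simp only [finrank_euclideanSpace, Fintype.card_fin, Set.toFinset_singleton,
      Finset.card_singleton] at h3 h4 h5
    simp only [V]
    omega
  choose N hcard hN using fun L => exists_grid_net (V L) hM
  refine ⟨(S ×ˢ S).biUnion N, ?_, fun z₁ z₂ h0 => ?_⟩
  · refine (Finset.card_biUnion_le_card_mul _ _ _ fun L _ =>
      (hcard L).trans (Nat.pow_le_pow_right (Nat.succ_pos _) (hV L))).trans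
      (Nat.mul_le_mul_right _ ?_)
    rw [Finset.card_product, sq]
    exact Nat.mul_le_mul hS hS
  · obtain ⟨L₁, hL₁, e₁⟩ := hz z₁
    obtain ⟨L₂, hL₂, e₂⟩ := hz z₂
    have hL : ∀ (L : EuclideanSpace ℝ (Fin k) →ᵃ[ℝ] EuclideanSpace ℝ (Fin n)) z,
        L z = L.linear z + L 0 := fun L z => by simpa using L.map_vadd 0 z
    have hmem : G z₁ - G z₂ ∈ V (L₁, L₂) := by
      have e : G z₁ - G z₂ = (L₁.linear z₁ - L₂.linear z₂) + (L₁ 0 - L₂ 0) := by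
        rw [e₁, e₂, hL L₁ z₁, hL L₂ z₂]
        abel
      rw [e]
      exact Submodule.add_mem_sup (Submodule.sub_mem _
        (Submodule.mem_sup_left (LinearMap.mem_range_self _ _))
        (Submodule.mem_sup_right (LinearMap.mem_range_self _ _)))
        (Submodule.mem_span_singleton_self _)
    have hx : ‖G z₁ - G z₂‖ ≠ 0 := norm_ne_zero_iff.2 h0
    obtain ⟨u, hu, hd⟩ := hN (L₁, L₂) (‖G z₁ - G z₂‖⁻¹ • (G z₁ - G z₂))
      (Submodule.smul_mem _ _ hmem) (by rw [norm_smul, norm_inv, norm_norm, inv_mul_cancel₀ hx])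
    refine ⟨‖G z₁ - G z₂‖, _, (smul_inv_smul₀ hx _).symm,
      by rw [norm_smul, norm_inv, norm_norm, inv_mul_cancel₀ hx], u,
      Finset.mem_biUnion.2 ⟨(L₁, L₂), Finset.mem_product.2 ⟨hL₁, hL₂⟩, hu⟩, hd.trans ?_⟩
    gcongr
    have := Submodule.finrank_le (V (L₁, L₂))
    rwa [finrank_euclideanSpace, Fintype.card_fin] at this

lemma norm_sq_toEuclideanLin_sub {Ω : Type*} {m n : ℕ} (A : Ω → Matrix (Fin m) (Fin n) ℝ) (ω : Ω)
    (x y : EuclideanSpace ℝ (Fin n)) :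
    ‖(A ω).toEuclideanLin x - (A ω).toEuclideanLin y‖ ^ 2 =
      ∑ i, (inner ℝ (matrixRow A i ω) (x - y)) ^ 2 := by
  rw [← map_sub, EuclideanSpace.real_norm_sq_eq]
  refine Finset.sum_congr rfl fun i _ => ?_
  simp [Matrix.toLpLin_apply, Matrix.mulVec, dotProduct, matrixRow, PiLp.inner_apply, mul_comm]

/-- With `n ≥ 2`, constants become powers of `n`: `n + 1 ≤ n ^ 2` and `3 * B ≤ n ^ p`. The exponent
is `8 + 3 * (p + 3) = 3 * p + 17`. -/
lemma net_card_le {n k d B p : ℕ} (hn : 2 ≤ n) (hk : 1 ≤ k) (hd : 1 ≤ d) (hB : 1 ≤ B)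
    (hp : 3 * B ≤ 2 ^ p) :
    (((n + 1) ^ (k + 1)) ^ d) ^ 2 * (2 * (B * n ^ 3) + 1) ^ (2 * k + 1) ≤
      n ^ ((3 * p + 17) * (k * d)) := by
  have hn1 : 1 ≤ n := by omega
  have h1 : (((n + 1) ^ (k + 1)) ^ d) ^ 2 ≤ n ^ (8 * (k * d)) := by
    calc _ ≤ (((n ^ 2) ^ (2 * k)) ^ d) ^ 2 := by
          gcongr
          · exact Nat.one_le_pow _ _ hn1
          · nlinarith
          · omega
      _ = _ := by simp only [← pow_mul]; congr 1; ring
  have h2 : (2 * (B * n ^ 3) + 1) ^ (2 * k + 1) ≤ n ^ ((p + 3) * (3 * (k * d))) := by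
    have hbase : 2 * (B * n ^ 3) + 1 ≤ n ^ (p + 3) := by
      have hBn : 1 ≤ B * n ^ 3 := Nat.mul_pos hB (by positivity)
      calc _ ≤ (3 * B) * n ^ 3 := by linarith
        _ ≤ n ^ p * n ^ 3 := by
            gcongr
            exact hp.trans (Nat.pow_le_pow_left hn p)
        _ = _ := by rw [pow_add]
    calc _ ≤ (n ^ (p + 3)) ^ (2 * k + 1) := Nat.pow_le_pow_left hbase _
      _ = n ^ ((p + 3) * (2 * k + 1)) := by rw [pow_mul]
      _ ≤ _ := by
          refine Nat.pow_le_pow_right hn1 (Nat.mul_le_mul_left _ ?_)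
          nlinarith
  calc _ ≤ n ^ (8 * (k * d)) * n ^ ((p + 3) * (3 * (k * d))) := Nat.mul_le_mul h1 h2
    _ = _ := by rw [← pow_add]; congr 1; ring

/-- The directions of the differences of a ReLU network have a net which is fine enough for the
truncated rows and small enough for the union bound. -/
lemma IsReLUNetwork.exists_net {C τ : ℝ} (hC : 0 < C) (hτ : 0 < τ) (hτ1 : τ ≤ 1) {B p : ℕ}
    (hB : 4 / τ + 24 * C ^ 4 / τ ^ 2 ≤ B) (hp : 3 * B ≤ 2 ^ p) {κ : ℝ} (hκ : 0 < κ)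
    {k d n m : ℕ} {G : EuclideanSpace ℝ (Fin k) → EuclideanSpace ℝ (Fin n)}
    (hG : IsReLUNetwork d G) (hm : (3 * p + 17) * (k * d * Real.log n) ≤ κ / 2 * m) :
    ∃ δ < 1, 2 * δ + 3 * δ * (4 * C ^ 4 * n ^ 2 / τ) ≤ τ / 2 ∧
      ∃ N : Finset (EuclideanSpace ℝ (Fin n)),
        N.card * Real.exp (-(κ * m)) ≤ Real.exp (-(κ / 2 * m)) ∧
        ∀ z₁ z₂, G z₁ - G z₂ ≠ 0 → ∃ r : ℝ, ∃ v, G z₁ - G z₂ = r • v ∧ ‖v‖ = 1 ∧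
          ∃ u ∈ N, ‖v - u‖ ≤ δ := by
  obtain ⟨hd, hpieces⟩ := hG.hasAffinePieces
  rcases Nat.eq_zero_or_pos k with rfl | hk
  · refine ⟨0, by norm_num, by simp; positivity, ∅, by simp [Real.exp_nonneg], fun z₁ z₂ h => ?_⟩
    exact absurd (by rw [Subsingleton.elim z₁ z₂, sub_self]) h
  rcases Nat.lt_or_ge n 2 with hn | hn
  · interval_cases n
    · refine ⟨0, by norm_num, by simp; positivity, ∅, by simp [Real.exp_nonneg], fun z₁ z₂ h => ?_⟩
      exact absurd (Subsingleton.elim _ _) h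
    -- Here `log n = 0`, so the hypothesis on `m` gives nothing; but in dimension one a single unit
    -- vector is an exact net.
    · refine ⟨0, by norm_num, by simp; positivity, {EuclideanSpace.single 0 1}, ?_, fun z₁ z₂ _ => ?_⟩
      · rw [Finset.card_singleton, Nat.cast_one, one_mul, Real.exp_le_exp]
        have : 0 ≤ κ * m := by positivity
        linarith
      · refine ⟨(G z₁ - G z₂) 0, EuclideanSpace.single 0 1, ?_, by simp, _,
          Finset.mem_singleton_self _, by simp⟩
        ext i
        rw [Subsingleton.elim i 0]
        simp
  · have hn' : (2 : ℝ) ≤ n := by exact_mod_cast hn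
    have h4 : 4 ≤ 4 / τ := by rw [le_div_iff₀ hτ]; linarith
    have h24 : 0 < 24 * C ^ 4 / τ ^ 2 := by positivity
    have hB4 : (4 : ℝ) ≤ B := by linarith
    have hB1 : 1 ≤ B := by
      have : (1 : ℝ) ≤ B := by linarith
      exact_mod_cast this
    -- The mesh becomes `1 / (B * n ^ 2)`, whose `n ^ 2` cancels that of the threshold.
    obtain ⟨N, hN, hnet⟩ := hpieces.exists_net (M := B * n ^ 3) (by positivity)
    have e : (n : ℝ) / (B * n ^ 3 : ℕ) = 1 / (B * n ^ 2) := by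
      push_cast
      field_simp
    have hBn : (4 : ℝ) ≤ B * n ^ 2 :=
      hB4.trans (le_mul_of_one_le_right (by linarith) (one_le_pow₀ (by linarith)))
    refine ⟨n / (B * n ^ 3 : ℕ), ?_, ?_, N, ?_, hnet⟩
    · rw [e, div_lt_one (by linarith)]
      linarith
    · have h1 : 1 / (B * n ^ 2 : ℝ) ≤ 1 / B := by
        apply one_div_le_one_div_of_le (by linarith)
        exact le_mul_of_one_le_right (by linarith) (one_le_pow₀ (by linarith))
      have h2 : 3 * (1 / (B * n ^ 2 : ℝ)) * (4 * C ^ 4 * n ^ 2 / τ) = 12 * C ^ 4 / (τ * B) := by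
        field_simp
        norm_num
      have h3 : 2 * (1 / (B : ℝ)) + 12 * C ^ 4 / (τ * B) =
          τ / 2 * ((4 / τ + 24 * C ^ 4 / τ ^ 2) / B) := by
        field_simp
        ring
      have h5 : (4 / τ + 24 * C ^ 4 / τ ^ 2) / B ≤ 1 := (div_le_one (by linarith)).2 hB
      rw [e, h2]
      nlinarith
    · have hcard : (N.card : ℝ) ≤ n ^ ((3 * p + 17) * (k * d)) := by
        exact_mod_cast hN.trans (net_card_le hn hk hd hB1 hp)
      have hpow : (n : ℝ) ^ ((3 * p + 17) * (k * d)) =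
          Real.exp ((3 * p + 17) * (k * d * Real.log n)) := by
        rw [← Real.exp_log (show (0 : ℝ) < n by linarith), ← Real.exp_nat_mul, Real.log_exp]
        push_cast
        congr 1
        ring
      calc _ ≤ Real.exp (κ / 2 * m) * Real.exp (-(κ * m)) := by
            gcongr
            exact hcard.trans (hpow.le.trans (Real.exp_le_exp.2 hm))
        _ = _ := by
            rw [← Real.exp_add]
            congr 1
            ring

theorem mainTheorem2 (C : ℝ) (hC : 0 < C) (γ : ℝ) (hγ0 : 0 ≤ γ) (hγ1 : γ < 1) :
    ∃ c₁ c₂ : ℝ, 0 < c₁ ∧ 0 < c₂ ∧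
      ∀ (k d n m : ℕ) (G : EuclideanSpace ℝ (Fin k) → EuclideanSpace ℝ (Fin n)),
        IsReLUNetwork d G →
        ∀ (Ω : Type*) [MeasurableSpace Ω] (P : Measure Ω) [IsProbabilityMeasure P]
          (A : Ω → Matrix (Fin m) (Fin n) ℝ),
          (∀ i, Measurable (matrixRow A i)) →
          iIndepFun (matrixRow A) P →
          (∀ i j, IdentDistrib (matrixRow A i) (matrixRow A j) P P) →
          (∀ i, IsIsotropic (matrixRow A i) P) →
          (∀ i, IsHeavyTailed C (matrixRow A i) P) →
          c₁ * (1 / (1 - γ ^ 2) * (k * d * Real.log n)) ≤ (m : ℝ) →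
          1 - Real.exp (-(c₂ * m)) ≤
            P.real {ω | ∀ z₁ z₂ : EuclideanSpace ℝ (Fin k),
              γ ^ 2 * ‖G z₁ - G z₂‖ ^ 2 ≤
                1 / (m : ℝ) *
                  ‖(A ω).toEuclideanLin (G z₁) - (A ω).toEuclideanLin (G z₂)‖ ^ 2} := by
  set τ : ℝ := 1 - γ ^ 2 with hτdef
  have hτ : 0 < τ := by nlinarith
  have hτ1 : τ ≤ 1 := by nlinarith
  obtain ⟨B, hB⟩ := exists_nat_ge (4 / τ + 24 * C ^ 4 / τ ^ 2)
  have hp : 3 * B ≤ 2 ^ (3 * B) := Nat.lt_two_pow_self.le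
  set p := 3 * B
  set κ : ℝ := τ ^ 2 / (32 * C ^ 4) with hκdef
  have hκ : 0 < κ := by positivity
  -- Half of the exponent `κ * m` absorbs the net's cardinality and half remains. Since `1 / τ ≥ 1`,
  -- that factor in the hypothesis can simply be dropped.
  refine ⟨2 * (3 * p + 17) / κ, κ / 2, by positivity, by positivity, ?_⟩
  intro k d n m G hG Ω _ P _ A hmeas hind _ hiso htail hm
  rcases Nat.eq_zero_or_pos m with rfl | hmpos
  · simp
  have hlog : 0 ≤ k * d * Real.log n := by positivity
  have hm' : (3 * p + 17) * (k * d * Real.log n) ≤ κ / 2 * m := by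
    have h1 : k * d * Real.log n ≤ 1 / τ * (k * d * Real.log n) :=
      le_mul_of_one_le_left hlog ((one_le_div hτ).2 hτ1)
    have h2 : 2 * (3 * p + 17) / κ * (k * d * Real.log n) ≤ m :=
      (mul_le_mul_of_nonneg_left h1 (by positivity)).trans hm
    calc _ = κ / 2 * (2 * (3 * p + 17) / κ * (k * d * Real.log n)) := by field_simp
      _ ≤ _ := by gcongr
  obtain ⟨δ, hδ1, hδ, N, hN, hnet⟩ := hG.exists_net hC hτ hτ1 hB hp hκ hm'
  have key := le_measureReal_forall_mem_of_net hC hτ hτ1 hmpos hmeas hind hiso htail hδ1 hδ N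
    {x | ∃ z₁ z₂, G z₁ - G z₂ = x} (by rintro _ ⟨z₁, z₂, rfl⟩; exact hnet z₁ z₂)
  refine (sub_le_sub_left hN 1).trans (key.trans (measureReal_mono fun ω hω z₁ z₂ => ?_))
  have := hω _ ⟨z₁, z₂, rfl⟩
  rwa [norm_sq_toEuclideanLin_sub, ← sub_sub_cancel 1 (γ ^ 2)]
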